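/- Let $\mathbb{T}=\mathbb{R}/\mathbb{Z}$ with Lebesgue measure $dx$, and let $L^2(\mathbb{T})$ be the space of complex-valued square-integrable functions on $\mathbb{T}$. For $t\in\mathbb{R}$ let $e^{it\partial_x^2}$ be the Schrödinger propagator on $L^2(\mathbb{T})$, i.e. the unitary operator that multiplies the $n$-th Fourier coefficient $\hat u_0(n)=\int_{\mathbb{T}}u_0(x)e^{-2\pi i n x}\,dx$ by $e^{-4\pi^2 i n^2 t}$ for every $n\in\mathbb{Z}$; thus $u(t)=e^{it\partial_x^2}u_0$ is the solution of $i\partial_t u+\partial_x^2u=0$, $u(0)=u_0$. **Theorem.** Let $\omega\subset\mathbb{T}$ be a nonempty open set and let $T>0$. Then there exists a constant $C>0$ (depending only on $\omega$ and $T$) such that for every $u_0\in L^2(\mathbb{T})$ the function $t\mapsto\|1_\omega\, e^{it\partial_x^2}u_0\|_{L^2(\mathbb{T})}^2$ is integrable on $[0,T]$ and $$\|u_0\|_{L^2(\mathbb{T})}^2\;\le\; C\int_0^T\big\|1_\omega\, e^{it\partial_x^2}u_0\big\|_{L^2(\mathbb{T})}^2\,dt .$$ -/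

import Mathlib

open MeasureTheory

noncomputable section

/-- `L²(𝕋)` for the one dimensional torus `𝕋 = ℝ/ℤ`, complex valued. The measure is the Haar measure
of total mass `1`, which on `ℝ/ℤ` is the Lebesgue measure `dx`. -/
abbrev L2Torus : Type := Lp ℂ 2 (AddCircle.haarAddCircle (T := (1 : ℝ)))

/-- The symbol `exp (i t (2πin)²)` of `e^{it∂ₓ²}`: on the mode `x ↦ exp (2πinx)` the derivative `∂ₓ`
acts as multiplication by `2πin`. -/
def schrodingerSymbol (t : ℝ) (n : ℤ) : ℂ :=
  Complex.exp (Complex.I * (t : ℂ) * (2 * (Real.pi : ℂ) * Complex.I * (n : ℂ)) ^ 2)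

theorem norm_schrodingerSymbol (t : ℝ) (n : ℤ) : ‖schrodingerSymbol t n‖ = 1 := by
  have h : Complex.I * (t : ℂ) * (2 * (Real.pi : ℂ) * Complex.I * (n : ℂ)) ^ 2 =
      ((-(t * (2 * Real.pi * n) ^ 2) : ℝ) : ℂ) * Complex.I := by
    push_cast
    linear_combination ((t : ℂ) * (2 * (Real.pi : ℂ) * n) ^ 2 * Complex.I) * Complex.I_sq
  rw [schrodingerSymbol, h, Complex.norm_exp_ofReal_mul_I]

theorem memlp_schrodinger (t : ℝ) (u₀ : L2Torus) :
    Memℓp (fun n : ℤ => schrodingerSymbol t n * fourierBasis.repr u₀ n) 2 := by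
  have h := lp.memℓp (fourierBasis.repr u₀)
  rw [memℓp_gen_iff (by norm_num)] at h ⊢
  simpa only [norm_mul, norm_schrodingerSymbol, one_mul] using h

/-- The propagator `e^{it∂ₓ²}` on `L²(𝕋)`: the `n`-th Fourier coefficient of `e^{it∂ₓ²} u₀` is
`exp (i t (2πin)²)` times the `n`-th Fourier coefficient of `u₀`. -/
def schrodingerFlow (t : ℝ) (u₀ : L2Torus) : L2Torus :=
  fourierBasis.repr.symm
    ⟨fun n : ℤ => schrodingerSymbol t n * fourierBasis.repr u₀ n, memlp_schrodinger t u₀⟩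

theorem fourierCoeff_schrodingerFlow (t : ℝ) (u₀ : L2Torus) (n : ℤ) :
    fourierCoeff (schrodingerFlow t u₀) n = schrodingerSymbol t n * fourierCoeff u₀ n := by
  rw [← fourierBasis_repr, ← fourierBasis_repr, schrodingerFlow,
    LinearIsometryEquiv.apply_symm_apply]

theorem schrodingerFlow_zero (u₀ : L2Torus) : schrodingerFlow 0 u₀ = u₀ := by
  apply fourierBasis.repr.injective
  ext n
  rw [fourierBasis_repr, fourierBasis_repr, fourierCoeff_schrodingerFlow]
  simp [schrodingerSymbol]

/-- The flow solves `i ∂ₜ u + ∂ₓ² u = 0`, mode by mode. -/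
theorem hasDerivAt_fourierCoeff_schrodingerFlow (t : ℝ) (u₀ : L2Torus) (n : ℤ) :
    ∃ d : ℂ, HasDerivAt (fun s : ℝ => fourierCoeff (schrodingerFlow s u₀) n) d t ∧
      Complex.I * d + (2 * (Real.pi : ℂ) * Complex.I * (n : ℂ)) ^ 2 *
        fourierCoeff (schrodingerFlow t u₀) n = 0 := by
  set a : ℂ := (2 * (Real.pi : ℂ) * Complex.I * (n : ℂ)) ^ 2 with ha
  refine ⟨Complex.I * a * fourierCoeff (schrodingerFlow t u₀) n, ?_, ?_⟩
  · simp only [fourierCoeff_schrodingerFlow, schrodingerSymbol, ← ha]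
    have h1 : HasDerivAt (fun s : ℝ => Complex.I * (s : ℂ) * a) (Complex.I * 1 * a) t :=
      ((Complex.ofRealCLM.hasDerivAt (x := t)).const_mul Complex.I).mul_const a
    refine ((h1.cexp).mul_const (fourierCoeff u₀ n)).congr_deriv ?_
    ring
  · linear_combination (a * fourierCoeff (schrodingerFlow t u₀) n) * Complex.I_sq

/-- Multiplication by the indicator function `1_ω` on `L²(𝕋)`, for `ω` measurable. -/
def cutoff (ω : Set (AddCircle (1 : ℝ))) (hω : MeasurableSet ω) (v : L2Torus) : L2Torus :=
  MemLp.toLp (ω.indicator v) ((Lp.memLp v).indicator hω)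

end

/-! The modes `n` and `-n` evolve with the same phase, so for finite Fourier sums `1_ω u(t)` is a
trigonometric polynomial in time, with values in `L²(𝕋)`, frequencies `-(2πk)²` for `k : ℕ`, and
coefficients `v_k = 1_ω (c_k e_k + c_{-k} e_{-k})`. Two lower bounds then combine.

In time, the frequencies are so sparse that `∑ (λ_j - λ_k)⁻²` converges over all pairs `j ≠ k`. Away
from finitely many frequencies the Gram matrix of the exponentials on `[0, T]` is a small
perturbation of `T` times the identity, and Haraux's argument restores the finitely many others one
at a time. This is `exists_le_integral_norm_sq_trigSum`: the time integral dominates `∑ ‖v_k‖²` for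
every `T > 0`.

In space, `‖v_k‖²` dominates `|c_k|² + |c_{-k}|²` uniformly in `k`
(`exists_le_norm_sq_cutoff_of_natAbs_eq`), because `ω` contains an arc on which the two exponentials
are uniformly independent. Parseval and density of the finite Fourier sums finish the proof. -/

open Complex in
/-- The nonharmonic trigonometric polynomial `t ↦ ∑_{k ∈ F} exp (i λ_k t) v_k`. -/
noncomputable def trigSum {ι H : Type*} [NormedAddCommGroup H] [InnerProductSpace ℂ H]
    (freq : ι → ℝ) (F : Finset ι) (v : ι → H) (t : ℝ) : H :=
  ∑ k ∈ F, exp ((freq k * t : ℝ) * I) • v k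

/-! ### Almost orthogonality of exponentials in time, with Hilbert-space coefficients. -/

section Ingham

variable {ι H : Type*} [NormedAddCommGroup H] [InnerProductSpace ℂ H] {freq : ι → ℝ}

open Complex

theorem continuous_trigSum (freq : ι → ℝ) (F : Finset ι) (v : ι → H) :
    Continuous (trigSum freq F v) := by
  unfold trigSum
  fun_prop

theorem intervalIntegrable_norm_sq_trigSum (freq : ι → ℝ) (F : Finset ι) (v : ι → H) (a b : ℝ) :
    IntervalIntegrable (fun t => ‖trigSum freq F v t‖ ^ 2) volume a b :=
  ((continuous_trigSum freq F v).norm.pow 2).intervalIntegrable a b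

theorem norm_integral_exp_le (θ : ℝ) (hθ : θ ≠ 0) (T : ℝ) :
    ‖∫ t in (0 : ℝ)..T, exp ((θ * t : ℝ) * I)‖ ≤ 2 * |θ|⁻¹ := by
  have h0 : (θ : ℂ) * I ≠ 0 := by simp [hθ]
  have h : ∀ t : ℝ, ((θ * t : ℝ) : ℂ) * I = (θ * I) * t := fun t => by push_cast; ring
  simp_rw [h]
  rw [integral_exp_mul_complex h0, norm_div]
  have h1 : ‖exp (θ * I * T) - exp (θ * I * (0 : ℝ))‖ ≤ 2 := by
    refine (norm_sub_le _ _).trans ?_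
    rw [← h, ← h, norm_exp_ofReal_mul_I, norm_exp_ofReal_mul_I]
    norm_num
  rw [div_eq_mul_inv]
  gcongr
  simp

theorem norm_sq_trigSum (freq : ι → ℝ) (F : Finset ι) (v : ι → H) (t : ℝ) :
    ‖trigSum freq F v t‖ ^ 2 = (∑ j ∈ F, ∑ k ∈ F,
      exp (((freq k - freq j) * t : ℝ) * I) * inner ℂ (v j) (v k)).re := by
  rw [norm_sq_eq_re_inner (𝕜 := ℂ), trigSum, sum_inner]
  simp_rw [inner_sum, inner_smul_left, inner_smul_right, ← mul_assoc]
  change Complex.re _ = _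
  congr 1
  refine Finset.sum_congr rfl fun j _ => Finset.sum_congr rfl fun k _ => ?_
  rw [← exp_conj, ← exp_add]
  congr 2
  simp only [map_mul, conj_I, conj_ofReal]
  push_cast
  ring

/-- The diagonal of the Gram matrix contributes exactly `T ∑ ‖v k‖²`. Off the diagonal the entries
are at most `2 / |λ_j - λ_k|`, and Cauchy–Schwarz over pairs bounds their contribution by a
Hilbert–Schmidt norm. Diagonal pairs add nothing to that norm since `0⁻¹ = 0`. -/
theorem abs_integral_norm_sq_trigSum_sub_le (hinj : Function.Injective freq) (F : Finset ι)
    (v : ι → H) (T : ℝ) :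
    |(∫ t in (0 : ℝ)..T, ‖trigSum freq F v t‖ ^ 2) - T * ∑ k ∈ F, ‖v k‖ ^ 2| ≤
      2 * √(∑ p ∈ F ×ˢ F, ((freq p.1 - freq p.2)⁻¹) ^ 2) * ∑ k ∈ F, ‖v k‖ ^ 2 := by
  classical
  set m : ι → ι → ℂ := fun j k => ∫ t in (0 : ℝ)..T, exp (((freq k - freq j) * t : ℝ) * I)
    with hm
  have hint : (∫ t in (0 : ℝ)..T, ‖trigSum freq F v t‖ ^ 2) =
      (∑ j ∈ F, ∑ k ∈ F, m j k * inner ℂ (v j) (v k)).re := by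
    simp_rw [norm_sq_trigSum]
    have hc : ∀ j k : ι, Continuous fun t : ℝ =>
        exp (((freq k - freq j) * t : ℝ) * I) * inner ℂ (v j) (v k) := fun j k => by fun_prop
    have := intervalIntegral.intervalIntegral_re (𝕜 := ℂ) (μ := volume) (a := 0) (b := T)
      (f := fun t : ℝ => ∑ j ∈ F, ∑ k ∈ F,
        exp (((freq k - freq j) * t : ℝ) * I) * inner ℂ (v j) (v k))
      ((continuous_finsetSum _ fun j _ => continuous_finsetSum _ fun k _ =>
        hc j k).intervalIntegrable _ _)
    refine this.trans ?_
    change Complex.re _ = _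
    rw [intervalIntegral.integral_finsetSum fun j _ =>
      (continuous_finsetSum _ fun k _ => hc j k).intervalIntegrable _ _]
    congr 1
    refine Finset.sum_congr rfl fun j _ => ?_
    rw [intervalIntegral.integral_finsetSum fun k _ => (hc j k).intervalIntegrable _ _]
    exact Finset.sum_congr rfl fun k _ => intervalIntegral.integral_mul_const _ _
  have hdiag : ∀ j, m j j = T := fun j => by simp [hm]
  have hsplit : ((∫ t in (0 : ℝ)..T, ‖trigSum freq F v t‖ ^ 2) - T * ∑ k ∈ F, ‖v k‖ ^ 2) =
      (∑ p ∈ F ×ˢ F, (if p.1 = p.2 then 0 else m p.1 p.2) * inner ℂ (v p.1) (v p.2)).re := by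
    rw [hint, Finset.sum_product, re_sum, re_sum, Finset.mul_sum, ← Finset.sum_sub_distrib]
    refine Finset.sum_congr rfl fun j hj => ?_
    have : T * ‖v j‖ ^ 2 =
        (∑ k ∈ F, if j = k then m j k * inner ℂ (v j) (v k) else 0).re := by
      rw [Finset.sum_ite_eq, if_pos hj, hdiag, inner_self_eq_norm_sq_to_K]
      simp [← ofReal_pow]
    rw [this, ← sub_re, ← Finset.sum_sub_distrib]
    congr 1
    refine Finset.sum_congr rfl fun k _ => ?_
    by_cases h : j = k <;> simp [h]
  rw [hsplit]
  refine (abs_re_le_norm _).trans ((norm_sum_le _ _).trans ?_)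
  have hterm : ∀ p ∈ F ×ˢ F,
      ‖(if p.1 = p.2 then 0 else m p.1 p.2) * inner ℂ (v p.1) (v p.2)‖ ≤
        2 * (|(freq p.1 - freq p.2)⁻¹| * (‖v p.1‖ * ‖v p.2‖)) := by
    rintro ⟨j, k⟩ -
    rw [norm_mul, ← mul_assoc]
    refine mul_le_mul ?_ (norm_inner_le_norm _ _) (norm_nonneg _) (by positivity)
    by_cases h : j = k
    · simp [h]
    · simp only [h, if_false]
      rw [abs_inv, abs_sub_comm]
      exact norm_integral_exp_le _ (sub_ne_zero.2 fun h' => h (hinj h').symm) T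
  refine (Finset.sum_le_sum hterm).trans ?_
  rw [← Finset.mul_sum, mul_assoc]
  refine mul_le_mul_of_nonneg_left ?_ zero_le_two
  refine (Real.sum_mul_le_sqrt_mul_sqrt _ _ _).trans (le_of_eq ?_)
  simp_rw [sq_abs, mul_pow]
  congr 1
  rw [Finset.sum_product]
  dsimp only
  rw [← Finset.sum_mul_sum, Real.sqrt_mul_self (by positivity)]

/-- This upper bound serves in Haraux's argument to absorb the other frequencies when a removed
coefficient is recovered. -/
theorem exists_integral_norm_sq_trigSum_le (hinj : Function.Injective freq)
    (hsum : Summable fun p : ι × ι => ((freq p.1 - freq p.2)⁻¹) ^ 2) (T : ℝ) :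
    ∃ C : ℝ, 0 ≤ C ∧ ∀ (F : Finset ι) (v : ι → H),
      ∫ t in (0 : ℝ)..T, ‖trigSum freq F v t‖ ^ 2 ≤ C * ∑ k ∈ F, ‖v k‖ ^ 2 := by
  refine ⟨|T| + 2 * √(∑' p : ι × ι, ((freq p.1 - freq p.2)⁻¹) ^ 2), by positivity, fun F v => ?_⟩
  have h := (abs_le.1 (abs_integral_norm_sq_trigSum_sub_le hinj F v T)).2
  have hs : ∑ p ∈ F ×ˢ F, ((freq p.1 - freq p.2)⁻¹) ^ 2 ≤
      ∑' p : ι × ι, ((freq p.1 - freq p.2)⁻¹) ^ 2 :=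
    hsum.sum_le_tsum _ fun _ _ => sq_nonneg _
  have h0 : 0 ≤ ∑ k ∈ F, ‖v k‖ ^ 2 := by positivity
  have h1 := mul_le_mul_of_nonneg_right (Real.sqrt_le_sqrt hs) h0
  have h2 := mul_le_mul_of_nonneg_right (le_abs_self T) h0
  linarith

theorem le_integral_norm_sq_trigSum_of_sum_le (hinj : Function.Injective freq) {T : ℝ} (hT : 0 < T)
    (F : Finset ι) (hF : ∑ p ∈ F ×ˢ F, ((freq p.1 - freq p.2)⁻¹) ^ 2 ≤ (T / 4) ^ 2) (v : ι → H) :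
    T / 2 * ∑ k ∈ F, ‖v k‖ ^ 2 ≤ ∫ t in (0 : ℝ)..T, ‖trigSum freq F v t‖ ^ 2 := by
  have h := (abs_le.1 (abs_integral_norm_sq_trigSum_sub_le hinj F v T)).1
  have h0 : 0 ≤ ∑ k ∈ F, ‖v k‖ ^ 2 := by positivity
  have h1 := mul_le_mul_of_nonneg_right (Real.sqrt_le_iff.2 ⟨by positivity, hF⟩) h0
  linarith

theorem exists_finset_le_integral_norm_sq_trigSum (hinj : Function.Injective freq)
    (hsum : Summable fun p : ι × ι => ((freq p.1 - freq p.2)⁻¹) ^ 2) {T : ℝ} (hT : 0 < T) :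
    ∃ s : Finset ι, ∀ (F : Finset ι) (v : ι → H), Disjoint F s →
      T / 2 * ∑ k ∈ F, ‖v k‖ ^ 2 ≤ ∫ t in (0 : ℝ)..T, ‖trigSum freq F v t‖ ^ 2 := by
  classical
  obtain ⟨s, hs⟩ := summable_iff_vanishing.1 hsum (Metric.ball 0 ((T / 4) ^ 2))
    (Metric.ball_mem_nhds _ (by positivity))
  -- Excluding the first coordinates of the pairs in `s` already makes `F ×ˢ F` disjoint from `s`.
  refine ⟨s.image Prod.fst, fun F v hF => le_integral_norm_sq_trigSum_of_sum_le hinj hT F ?_ v⟩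
  have h := hs (F ×ˢ F) (Finset.disjoint_left.2 fun p hp hps =>
    Finset.disjoint_left.1 hF (Finset.mem_product.1 hp).1 (Finset.mem_image_of_mem _ hps))
  rw [mem_ball_zero_iff, Real.norm_eq_abs] at h
  exact (le_abs_self _).trans h.le

end Ingham

theorem norm_sq_sub_le {H : Type*} [SeminormedAddCommGroup H] (x y : H) :
    ‖x - y‖ ^ 2 ≤ 2 * ‖x‖ ^ 2 + 2 * ‖y‖ ^ 2 := by
  have h := norm_sub_le x y
  nlinarith [sq_nonneg (‖x‖ - ‖y‖), norm_nonneg (x - y)]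

/-! ### Haraux's argument: restoring finitely many frequencies. -/

section Haraux

variable {ι H : Type*} [NormedAddCommGroup H] [InnerProductSpace ℂ H] {freq : ι → ℝ}

open Complex

theorem norm_sq_exp_sub_one (θ : ℝ) : ‖exp ((θ : ℝ) * I) - 1‖ ^ 2 = 2 - 2 * Real.cos θ := by
  rw [← normSq_eq_norm_sq, normSq_apply]
  simp only [sub_re, exp_ofReal_mul_I_re, one_re, sub_im, exp_ofReal_mul_I_im, one_im]
  linear_combination Real.sin_sq_add_cos_sq θ

theorem integral_norm_sq_exp_sub_one {θ : ℝ} (hθ : θ ≠ 0) (δ : ℝ) :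
    ∫ s in (0 : ℝ)..δ, ‖exp ((θ * s : ℝ) * I) - 1‖ ^ 2 = 2 * (δ - Real.sin (θ * δ) / θ) := by
  simp_rw [norm_sq_exp_sub_one]
  rw [intervalIntegral.integral_sub (by simp) (Continuous.intervalIntegrable (by fun_prop) _ _),
    intervalIntegral.integral_const_mul, intervalIntegral.integral_comp_mul_left _ hθ]
  simp
  ring

theorem integral_norm_sq_exp_sub_one_pos {θ : ℝ} (hθ : θ ≠ 0) {δ : ℝ} (hδ : 0 < δ) :
    0 < ∫ s in (0 : ℝ)..δ, ‖exp ((θ * s : ℝ) * I) - 1‖ ^ 2 := by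
  rw [integral_norm_sq_exp_sub_one hθ]
  have hne : θ * δ ≠ 0 := mul_ne_zero hθ hδ.ne'
  have h : |Real.sin (θ * δ)| < |θ * δ| := Real.abs_sin_lt_abs hne
  have h2 : Real.sin (θ * δ) / θ ≤ |Real.sin (θ * δ)| / |θ| := by
    rw [← abs_div]
    exact le_abs_self _
  have h3 : |Real.sin (θ * δ)| / |θ| < δ := by
    rw [div_lt_iff₀ (abs_pos.2 hθ)]
    rwa [abs_mul, abs_of_pos hδ, mul_comm |θ|] at h
  linarith

theorem le_integral_norm_sq_exp_sub_one {θ δ : ℝ} (hδ : 0 < δ) (h : θ⁻¹ ^ 2 < (δ / 2) ^ 2)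
    (hθ : θ ≠ 0) : δ ≤ ∫ s in (0 : ℝ)..δ, ‖exp ((θ * s : ℝ) * I) - 1‖ ^ 2 := by
  rw [integral_norm_sq_exp_sub_one hθ]
  have h1 : |θ⁻¹| < δ / 2 := by
    rw [sq_lt_sq, abs_of_pos (half_pos hδ)] at h
    exact h
  have h2 : Real.sin (θ * δ) / θ ≤ |θ⁻¹| := by
    refine (le_abs_self _).trans ?_
    rw [div_eq_mul_inv, abs_mul]
    exact mul_le_of_le_one_left (abs_nonneg _) (Real.abs_sin_le_one _)
  linarith

/-- By summability, `|λ_k - λ_m| > 2 / δ` for all but finitely many `k ≠ m`, where the integral is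
at least `δ`. The remaining integrals are positive and finite in number, so they have a positive
minimum. -/
theorem exists_le_integral_norm_sq_exp_sub_one (hinj : Function.Injective freq)
    (hsum : Summable fun p : ι × ι => ((freq p.1 - freq p.2)⁻¹) ^ 2) (m : ι) {δ : ℝ} (hδ : 0 < δ) :
    ∃ c : ℝ, 0 < c ∧ ∀ k, k ≠ m →
      c ≤ ∫ s in (0 : ℝ)..δ, ‖exp (((freq k - freq m) * s : ℝ) * I) - 1‖ ^ 2 := by
  classical
  set φ : ι → ℝ := fun k => ∫ s in (0 : ℝ)..δ, ‖exp (((freq k - freq m) * s : ℝ) * I) - 1‖ ^ 2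
  have hm : Summable fun k : ι => ((freq k - freq m)⁻¹) ^ 2 :=
    hsum.comp_injective (i := fun k : ι => (k, m)) fun a b h => congrArg Prod.fst h
  have hfin := hm.tendsto_cofinite_zero.eventually_lt_const (u := (δ / 2) ^ 2) (by positivity)
  rw [Filter.eventually_cofinite] at hfin
  have hne : ∀ k, k ≠ m → freq k - freq m ≠ 0 := fun k hk =>
    sub_ne_zero.2 fun h => hk (hinj h)
  set s := hfin.toFinset.erase m
  obtain ⟨c, hc, hcs⟩ : ∃ c : ℝ, 0 < c ∧ ∀ k ∈ s, c ≤ φ k := by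
    rcases s.eq_empty_or_nonempty with h | h
    · exact ⟨1, one_pos, by simp [h]⟩
    · obtain ⟨k, hk, hmin⟩ := s.exists_min_image φ h
      exact ⟨φ k, integral_norm_sq_exp_sub_one_pos (hne k (Finset.ne_of_mem_erase hk)) hδ, hmin⟩
  refine ⟨min c δ, lt_min hc hδ, fun k hk => ?_⟩
  by_cases hks : k ∈ s
  · exact (min_le_left _ _).trans (hcs k hks)
  · refine (min_le_right _ _).trans (le_integral_norm_sq_exp_sub_one hδ ?_ (hne k hk))
    by_contra hlt
    exact hks (Finset.mem_erase.2 ⟨hk, by simpa using hlt⟩)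

theorem integral_le_integral_of_subset {f : ℝ → ℝ} (hf : Continuous f) (h0 : ∀ t, 0 ≤ f t)
    {a b c d : ℝ} (hca : c ≤ a) (hab : a ≤ b) (hbd : b ≤ d) :
    ∫ t in a..b, f t ≤ ∫ t in c..d, f t :=
  intervalIntegral.integral_mono_interval hca hab hbd (Filter.Eventually.of_forall h0)
    (hf.intervalIntegrable _ _)

/-- The combination `exp (-i λ_m s) f (t + s) - f t` of translates of a nonharmonic polynomial does
not contain the frequency `λ_m`. -/
theorem exp_smul_trigSum_add_sub [DecidableEq ι] (F : Finset ι) (v : ι → H) (m : ι) (s t : ℝ) :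
    exp ((-(freq m) * s : ℝ) * I) • trigSum freq F v (t + s) - trigSum freq F v t =
      trigSum freq (F.erase m) (fun k => (exp (((freq k - freq m) * s : ℝ) * I) - 1) • v k) t := by
  have hm : exp ((freq m * t : ℝ) * I) • (exp (((freq m - freq m) * s : ℝ) * I) - 1) • v m = 0 := by
    simp
  unfold trigSum
  rw [Finset.sum_erase (f := fun k => exp ((freq k * t : ℝ) * I) •
      (exp (((freq k - freq m) * s : ℝ) * I) - 1) • v k) F hm, Finset.smul_sum, ← Finset.sum_sub_distrib]
  refine Finset.sum_congr rfl fun k _ => ?_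
  rw [smul_smul, smul_smul, ← sub_smul, mul_sub, mul_one, ← exp_add, ← exp_add]
  congr 3
  push_cast
  ring

theorem integral_norm_sq_exp_smul_trigSum_add_sub_le (F : Finset ι) (v : ι → H) (m : ι)
    {s δ τ : ℝ} (hs : 0 ≤ s) (hsδ : s ≤ δ) (hτ : 0 ≤ τ) :
    ∫ t in (0 : ℝ)..τ, ‖exp ((-(freq m) * s : ℝ) * I) • trigSum freq F v (t + s) -
      trigSum freq F v t‖ ^ 2 ≤ 4 * ∫ t in (0 : ℝ)..(τ + δ), ‖trigSum freq F v t‖ ^ 2 := by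
  set f := trigSum freq F v
  have hf : Continuous f := continuous_trigSum _ _ _
  have hf2 : Continuous fun t => ‖f t‖ ^ 2 := by fun_prop
  calc _ ≤ ∫ t in (0 : ℝ)..τ, (2 * ‖f (t + s)‖ ^ 2 + 2 * ‖f t‖ ^ 2) := by
        refine intervalIntegral.integral_mono_on hτ
          (Continuous.intervalIntegrable (by fun_prop) _ _)
          (Continuous.intervalIntegrable (by fun_prop) _ _) fun t _ => ?_
        refine (norm_sq_sub_le _ _).trans (le_of_eq ?_)
        rw [norm_smul, norm_exp_ofReal_mul_I, one_mul]
    _ = 2 * (∫ t in s..(τ + s), ‖f t‖ ^ 2) + 2 * ∫ t in (0 : ℝ)..τ, ‖f t‖ ^ 2 := by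
        rw [intervalIntegral.integral_add (Continuous.intervalIntegrable (by fun_prop) _ _)
          (Continuous.intervalIntegrable (by fun_prop) _ _),
          intervalIntegral.integral_const_mul, intervalIntegral.integral_const_mul,
          intervalIntegral.integral_comp_add_right (fun t => ‖f t‖ ^ 2), zero_add]
    _ ≤ _ := by
        have h1 := integral_le_integral_of_subset hf2 (fun t => by positivity) hs
          (by linarith : s ≤ τ + s) (by linarith : τ + s ≤ τ + δ)
        have h2 := integral_le_integral_of_subset hf2 (fun t => by positivity) le_rfl hτ
          (by linarith : τ ≤ τ + δ)
        linarith

/-- Haraux's argument: a lower bound for the frequencies different from `λ_m` gives control of all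
coefficients except the one of `λ_m` when this frequency is added, on any longer interval. -/
theorem sum_erase_le_of_lower_bound [DecidableEq ι] {τ δ c κ : ℝ} (hτ : 0 ≤ τ) (hδ : 0 < δ)
    (F : Finset ι) (m : ι) (hc : 0 < c)
    (hlow : ∀ w : ι → H, c * ∑ k ∈ F.erase m, ‖w k‖ ^ 2 ≤
      ∫ t in (0 : ℝ)..τ, ‖trigSum freq (F.erase m) w t‖ ^ 2)
    (hκ : ∀ k, k ≠ m →
      κ ≤ ∫ s in (0 : ℝ)..δ, ‖exp (((freq k - freq m) * s : ℝ) * I) - 1‖ ^ 2) (v : ι → H) :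
    c * κ * ∑ k ∈ F.erase m, ‖v k‖ ^ 2 ≤
      4 * δ * ∫ t in (0 : ℝ)..(τ + δ), ‖trigSum freq F v t‖ ^ 2 := by
  set M := ∫ t in (0 : ℝ)..(τ + δ), ‖trigSum freq F v t‖ ^ 2
  have hs : ∀ s ∈ Set.Icc 0 δ,
      c * ∑ k ∈ F.erase m, ‖exp (((freq k - freq m) * s : ℝ) * I) - 1‖ ^ 2 * ‖v k‖ ^ 2 ≤ 4 * M := by
    intro s hs
    have h := hlow fun k => (exp (((freq k - freq m) * s : ℝ) * I) - 1) • v k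
    simp_rw [← exp_smul_trigSum_add_sub, norm_smul, mul_pow] at h
    exact h.trans (integral_norm_sq_exp_smul_trigSum_add_sub_le F v m hs.1 hs.2 hτ)
  -- A single shift `s` may annihilate some factor `exp (i(λ_k - λ_m)s) - 1`; averaging over `s ∈
  -- [0, δ]` prevents this.
  have hint := intervalIntegral.integral_mono_on (μ := volume) hδ.le
    (Continuous.intervalIntegrable (by fun_prop) _ _) (by simp) hs
  rw [intervalIntegral.integral_const_mul, intervalIntegral.integral_finsetSum
    fun k _ => Continuous.intervalIntegrable (by fun_prop) _ _] at hint
  simp_rw [intervalIntegral.integral_mul_const] at hint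
  rw [intervalIntegral.integral_const, smul_eq_mul, sub_zero] at hint
  refine le_trans ?_ (hint.trans (by linarith))
  rw [mul_assoc, Finset.mul_sum]
  refine mul_le_mul_of_nonneg_left (Finset.sum_le_sum fun k hk => ?_) hc.le
  exact mul_le_mul_of_nonneg_right (hκ k (Finset.ne_of_mem_erase hk)) (sq_nonneg _)

/-- The term of frequency `λ_m` is the full sum minus the sum over the others, and its norm is
constant in time. -/
theorem mul_norm_sq_le_integral [DecidableEq ι] {τ : ℝ} (hτ : 0 ≤ τ) (F : Finset ι) {m : ι}
    (hm : m ∈ F) (v : ι → H) :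
    τ * ‖v m‖ ^ 2 ≤ 2 * (∫ t in (0 : ℝ)..τ, ‖trigSum freq F v t‖ ^ 2) +
      2 * ∫ t in (0 : ℝ)..τ, ‖trigSum freq (F.erase m) v t‖ ^ 2 := by
  have h1 := intervalIntegrable_norm_sq_trigSum freq F v 0 τ
  have h2 := intervalIntegrable_norm_sq_trigSum freq (F.erase m) v 0 τ
  rw [← intervalIntegral.integral_const_mul, ← intervalIntegral.integral_const_mul,
    ← intervalIntegral.integral_add (h1.const_mul 2) (h2.const_mul 2)]
  have hconst : τ * ‖v m‖ ^ 2 = ∫ _ in (0 : ℝ)..τ, ‖v m‖ ^ 2 := by simp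
  rw [hconst]
  refine intervalIntegral.integral_mono_on hτ (by simp) ((h1.const_mul 2).add (h2.const_mul 2))
    fun t _ => ?_
  refine le_trans (le_of_eq ?_) (norm_sq_sub_le _ _)
  have : trigSum freq F v t - trigSum freq (F.erase m) v t = exp ((freq m * t : ℝ) * I) • v m := by
    unfold trigSum
    rw [← Finset.add_sum_erase F _ hm, add_sub_cancel_right]
  rw [this, norm_smul, norm_exp_ofReal_mul_I, one_mul]

theorem exists_lower_bound_of_insert [DecidableEq ι] (hinj : Function.Injective freq)
    (hsum : Summable fun p : ι × ι => ((freq p.1 - freq p.2)⁻¹) ^ 2) {τ δ c : ℝ} (hτ : 0 < τ)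
    (hδ : 0 < δ) (hc : 0 < c) (s : Finset ι) (m : ι)
    (hlow : ∀ (F : Finset ι) (v : ι → H), Disjoint F (insert m s) →
      c * ∑ k ∈ F, ‖v k‖ ^ 2 ≤ ∫ t in (0 : ℝ)..τ, ‖trigSum freq F v t‖ ^ 2) :
    ∃ c' : ℝ, 0 < c' ∧ ∀ (F : Finset ι) (v : ι → H), Disjoint F s →
      c' * ∑ k ∈ F, ‖v k‖ ^ 2 ≤ ∫ t in (0 : ℝ)..(τ + δ), ‖trigSum freq F v t‖ ^ 2 := by
  obtain ⟨κ, hκ0, hκ⟩ := exists_le_integral_norm_sq_exp_sub_one hinj hsum m hδ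
  obtain ⟨C, hC0, hC⟩ := exists_integral_norm_sq_trigSum_le (H := H) hinj hsum τ
  -- `A` bounds the coefficients other than `m`; the second summand of `B` bounds the one at `m`.
  set A : ℝ := 4 * δ / (c * κ)
  have hA : 0 < A := by positivity
  set B : ℝ := A + (2 + 2 * (C * A)) / τ
  have hB : 0 < B := by positivity
  refine ⟨B⁻¹, by positivity, fun F v hF => ?_⟩
  set M := ∫ t in (0 : ℝ)..(τ + δ), ‖trigSum freq F v t‖ ^ 2
  have hdisj : Disjoint (F.erase m) (insert m s) := by
    rw [Finset.disjoint_insert_right]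
    exact ⟨Finset.notMem_erase m F, hF.mono_left (Finset.erase_subset m F)⟩
  have hfcont : Continuous fun t => ‖trigSum freq F v t‖ ^ 2 :=
    (continuous_trigSum freq F v).norm.pow 2
  have hM : ∫ t in (0 : ℝ)..τ, ‖trigSum freq F v t‖ ^ 2 ≤ M :=
    integral_le_integral_of_subset hfcont (fun t => by positivity) le_rfl hτ.le (by linarith)
  have hM0 : 0 ≤ M := intervalIntegral.integral_nonneg (by linarith) fun t _ => by positivity
  have h1 : ∑ k ∈ F.erase m, ‖v k‖ ^ 2 ≤ A * M := by
    have := sum_erase_le_of_lower_bound hτ.le hδ F m hc (fun w => hlow _ w hdisj) hκ v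
    rw [div_mul_eq_mul_div, le_div_iff₀ (by positivity), mul_comm]
    exact this
  rw [inv_mul_le_iff₀ hB]
  by_cases hm : m ∈ F
  · have h2 := mul_norm_sq_le_integral (freq := freq) hτ.le F hm v
    have h3 := (hC (F.erase m) v).trans (mul_le_mul_of_nonneg_left h1 hC0)
    have h4 : ‖v m‖ ^ 2 ≤ (2 + 2 * (C * A)) / τ * M := by
      rw [div_mul_eq_mul_div, le_div_iff₀ hτ]
      linarith
    rw [← Finset.add_sum_erase F _ hm, add_mul]
    linarith
  · rw [Finset.erase_eq_of_notMem hm] at h1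
    refine h1.trans (mul_le_mul_of_nonneg_right ?_ hM0)
    exact le_add_of_nonneg_right (by positivity)

/-- **Ingham's inequality**, in the form due to Haraux: for frequencies `λ_k` which are distinct and
separated enough for `∑_{j ≠ k} (λ_j - λ_k)⁻²` to converge, on an interval of any length. -/
theorem exists_le_integral_norm_sq_trigSum (H : Type*) [NormedAddCommGroup H]
    [InnerProductSpace ℂ H] (hinj : Function.Injective freq)
    (hsum : Summable fun p : ι × ι => ((freq p.1 - freq p.2)⁻¹) ^ 2) {T : ℝ} (hT : 0 < T) :
    ∃ c : ℝ, 0 < c ∧ ∀ (F : Finset ι) (v : ι → H),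
      c * ∑ k ∈ F, ‖v k‖ ^ 2 ≤ ∫ t in (0 : ℝ)..T, ‖trigSum freq F v t‖ ^ 2 := by
  classical
  obtain ⟨s₀, hs₀⟩ := exists_finset_le_integral_norm_sq_trigSum (H := H) hinj hsum (half_pos hT)
  -- Each restored frequency costs some extra length, which can be arbitrarily small. Quantifying
  -- over all `τ > T / 2` lets the induction pay this cost finitely often and still reach `T`.
  have key : ∀ s : Finset ι, (∀ τ, T / 2 < τ → ∃ c : ℝ, 0 < c ∧ ∀ (F : Finset ι) (v : ι → H),
      Disjoint F s → c * ∑ k ∈ F, ‖v k‖ ^ 2 ≤ ∫ t in (0 : ℝ)..τ, ‖trigSum freq F v t‖ ^ 2) →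
      ∀ τ, T / 2 < τ → ∃ c : ℝ, 0 < c ∧ ∀ (F : Finset ι) (v : ι → H),
        c * ∑ k ∈ F, ‖v k‖ ^ 2 ≤ ∫ t in (0 : ℝ)..τ, ‖trigSum freq F v t‖ ^ 2 := by
    intro s
    induction s using Finset.induction_on with
    | empty => simp
    | insert m s _ ih =>
      intro h
      refine ih fun τ hτ => ?_
      obtain ⟨τ', h1, h2⟩ := exists_between hτ
      obtain ⟨c, hc, hlow⟩ := h τ' h1
      have := exists_lower_bound_of_insert hinj hsum (by linarith : 0 < τ')
        (sub_pos.2 h2) hc s m hlow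
      rwa [add_sub_cancel] at this
  refine key s₀ (fun τ hτ => ⟨T / 2 / 2, by positivity, fun F v hF => (hs₀ F v hF).trans ?_⟩) T
    (half_lt_self hT)
  exact integral_le_integral_of_subset ((continuous_trigSum freq F v).norm.pow 2)
    (fun t => sq_nonneg ‖trigSum freq F v t‖) le_rfl (half_pos hT).le hτ.le

end Haraux

/-! ### Uniform independence on an arc, and the gaps between squares. -/

section Arc

open Complex

theorem exists_le_integral_norm_sq_trigSum_of_subset {ι : Type*} {freq : ι → ℝ} (H : Type*)
    [NormedAddCommGroup H] [InnerProductSpace ℂ H] (hinj : Function.Injective freq) (s : Finset ι)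
    {T : ℝ} (hT : 0 < T) :
    ∃ c : ℝ, 0 < c ∧ ∀ (F : Finset ι) (v : ι → H), F ⊆ s →
      c * ∑ k ∈ F, ‖v k‖ ^ 2 ≤ ∫ t in (0 : ℝ)..T, ‖trigSum freq F v t‖ ^ 2 := by
  classical
  obtain ⟨c, hc, h⟩ := exists_le_integral_norm_sq_trigSum (freq := fun k : s => freq k) H
    (hinj.comp Subtype.val_injective) (Summable.of_finite) hT
  refine ⟨c, hc, fun F v hF => ?_⟩
  have h1 := h (F.subtype (· ∈ s)) (fun k => v k)
  rw [Finset.sum_subtype_of_mem (fun k => ‖v k‖ ^ 2) hF] at h1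
  refine h1.trans (le_of_eq (intervalIntegral.integral_congr fun t _ => ?_))
  congr 2
  exact Finset.sum_subtype_of_mem (fun k => exp ((freq k * t : ℝ) * I) • v k) hF

theorem injective_two_pi_mul : Function.Injective fun n : ℤ => 2 * Real.pi * (n : ℝ) :=
  fun _ _ h => Int.cast_injective (mul_left_cancel₀ Real.two_pi_pos.ne' h)

/-- The functions `exp (2πikx)` and `exp (-2πikx)` are linearly independent on an interval,
uniformly in `k`. -/
theorem exists_le_integral_norm_sq_trigSum_of_natAbs_eq {ℓ : ℝ} (hℓ : 0 < ℓ) :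
    ∃ κ : ℝ, 0 < κ ∧ ∀ (k : ℕ) (F : Finset ℤ) (c : ℤ → ℂ), (∀ n ∈ F, n.natAbs = k) →
      κ * ∑ n ∈ F, ‖c n‖ ^ 2 ≤
        ∫ x in (0 : ℝ)..ℓ, ‖trigSum (fun n : ℤ => 2 * Real.pi * n) F c x‖ ^ 2 := by
  -- For `k ≤ K` all frequencies lie in a fixed finite set. For `k > K` the gap `4πk` is so large
  -- compared with `1 / ℓ` that almost orthogonality applies directly.
  obtain ⟨K, hK⟩ := exists_nat_gt (4 / ℓ)
  obtain ⟨κ, hκ, h⟩ := exists_le_integral_norm_sq_trigSum_of_subset ℂ injective_two_pi_mul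
    (Finset.Icc (-(K : ℤ)) K) hℓ
  refine ⟨min κ (ℓ / 2), by positivity, fun k F c hF => ?_⟩
  have h0 : 0 ≤ ∑ n ∈ F, ‖c n‖ ^ 2 := by positivity
  rcases le_or_gt k K with hk | hk
  · refine (mul_le_mul_of_nonneg_right (min_le_left _ _) h0).trans (h F c fun n hn => ?_)
    have := hF n hn
    rw [Finset.mem_Icc]
    omega
  · refine (mul_le_mul_of_nonneg_right (min_le_right _ _) h0).trans
      (le_integral_norm_sq_trigSum_of_sum_le injective_two_pi_mul hℓ F ?_ c)
    have hsub : F ⊆ {(k : ℤ), -(k : ℤ)} := fun n hn => by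
      have := hF n hn
      rw [Finset.mem_insert, Finset.mem_singleton]
      omega
    have hk0 : (0 : ℝ) < k := (Nat.cast_nonneg K).trans_lt (Nat.cast_lt.2 hk)
    have hkℓ : 4 < ℓ * k := by
      rw [div_lt_iff₀ hℓ, mul_comm] at hK
      exact hK.trans (mul_lt_mul_of_pos_left (Nat.cast_lt.2 hk) hℓ)
    have hne : (k : ℤ) ≠ -(k : ℤ) := by omega
    refine (Finset.sum_le_sum_of_subset_of_nonneg (Finset.product_subset_product hsub hsub)
      fun _ _ _ => sq_nonneg _).trans ?_
    rw [Finset.sum_product, Finset.sum_pair hne, Finset.sum_pair hne, Finset.sum_pair hne]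
    have e1 : (2 * Real.pi * ((k : ℤ) : ℝ) - 2 * Real.pi * ((-(k : ℤ) : ℤ) : ℝ)) =
        4 * Real.pi * k := by push_cast; ring
    have e2 : (2 * Real.pi * ((-(k : ℤ) : ℤ) : ℝ) - 2 * Real.pi * ((k : ℤ) : ℝ)) =
        -(4 * Real.pi * k) := by push_cast; ring
    simp only [sub_self, e1, e2]
    have e3 : (4 * Real.pi * k)⁻¹ ≤ ℓ / 8 := by
      rw [inv_le_comm₀ (by positivity) (by positivity), inv_div, div_le_iff₀ hℓ]
      nlinarith [Real.pi_gt_three]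
    have e4 : 0 ≤ (4 * Real.pi * k)⁻¹ := by positivity
    rw [inv_neg, neg_sq, inv_zero]
    nlinarith

theorem trigSum_add {ι H : Type*} [NormedAddCommGroup H] [InnerProductSpace ℂ H] (freq : ι → ℝ)
    (F : Finset ι) (v : ι → H) (a t : ℝ) :
    trigSum freq F v (t + a) = trigSum freq F (fun k => exp ((freq k * a : ℝ) * I) • v k) t := by
  unfold trigSum
  refine Finset.sum_congr rfl fun k _ => ?_
  rw [smul_smul, ← exp_add]
  congr 2
  push_cast
  ring

theorem exists_le_integral_norm_sq_trigSum_of_natAbs_eq' {a b : ℝ} (hab : a < b) :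
    ∃ κ : ℝ, 0 < κ ∧ ∀ (k : ℕ) (F : Finset ℤ) (c : ℤ → ℂ), (∀ n ∈ F, n.natAbs = k) →
      κ * ∑ n ∈ F, ‖c n‖ ^ 2 ≤
        ∫ x in a..b, ‖trigSum (fun n : ℤ => 2 * Real.pi * n) F c x‖ ^ 2 := by
  obtain ⟨κ, hκ, h⟩ := exists_le_integral_norm_sq_trigSum_of_natAbs_eq (sub_pos.2 hab)
  refine ⟨κ, hκ, fun k F c hF => ?_⟩
  have h1 := h k F (fun n => exp ((2 * Real.pi * (n : ℝ) * a : ℝ) * I) • c n) hF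
  simp_rw [← trigSum_add (fun n : ℤ => 2 * Real.pi * (n : ℝ)) F c a, norm_smul, norm_exp_ofReal_mul_I, one_mul] at h1
  rw [intervalIntegral.integral_comp_add_right
    (fun x => ‖trigSum (fun n : ℤ => 2 * Real.pi * n) F c x‖ ^ 2)] at h1
  simpa using h1

theorem injective_neg_two_pi_mul_sq :
    Function.Injective fun k : ℕ => -(2 * Real.pi * (k : ℝ)) ^ 2 := by
  intro j k h
  have h1 := (pow_left_inj₀ (by positivity) (by positivity) two_ne_zero).1 (neg_injective h)
  exact Nat.cast_injective (mul_left_cancel₀ Real.two_pi_pos.ne' h1)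

/-- Since `j² - k² = (j - k)(j + k)` and `(j, k) ↦ (j - k, j + k)` is injective, the sum is
dominated by a product of two convergent series `∑ n⁻²` over `ℤ`. -/
theorem summable_inv_sub_sq :
    Summable fun p : ℕ × ℕ =>
      ((-(2 * Real.pi * (p.1 : ℝ)) ^ 2 - -(2 * Real.pi * (p.2 : ℝ)) ^ 2)⁻¹) ^ 2 := by
  have h1 : Summable fun n : ℤ => ((n : ℝ) ^ 2)⁻¹ := by
    simpa using Real.summable_one_div_int_pow.2 one_lt_two
  have h2 := (h1.mul_of_nonneg h1 (fun _ => by positivity) fun _ => by positivity).comp_injective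
    (i := fun p : ℕ × ℕ => ((p.1 - p.2 : ℤ), (p.1 + p.2 : ℤ))) fun p q h => by
      simp only [Prod.mk.injEq] at h
      ext <;> omega
  refine (h2.mul_left (((2 * Real.pi) ^ 4)⁻¹)).congr fun p => ?_
  simp only [Function.comp_apply]
  push_cast
  rw [← mul_inv, ← mul_inv, inv_pow]
  congr 1
  ring

end Arc

/-! ### The propagator and the cutoff on the torus. -/

section Torus

open Complex

theorem repr_schrodingerFlow (t : ℝ) (u : L2Torus) (n : ℤ) :
    fourierBasis.repr (schrodingerFlow t u) n = schrodingerSymbol t n * fourierBasis.repr u n := by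
  rw [fourierBasis_repr, fourierBasis_repr, fourierCoeff_schrodingerFlow]

/-- The propagator `e^{it∂ₓ²}` as a linear isometry. -/
noncomputable def schrodingerIsometry (t : ℝ) : L2Torus →ₗᵢ[ℂ] L2Torus where
  toFun := schrodingerFlow t
  map_add' u w := by
    apply fourierBasis.repr.injective
    ext n
    simp only [map_add, lp.coeFn_add, Pi.add_apply, repr_schrodingerFlow, mul_add]
  map_smul' c u := by
    apply fourierBasis.repr.injective
    ext n
    simp only [map_smul, lp.coeFn_smul, Pi.smul_apply, repr_schrodingerFlow, smul_eq_mul,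
      RingHom.id_apply]
    ring
  norm_map' u := by
    change ‖schrodingerFlow t u‖ = ‖u‖
    rw [← fourierBasis.repr.norm_map, ← fourierBasis.repr.norm_map u,
      lp.norm_eq_tsum_rpow (by norm_num), lp.norm_eq_tsum_rpow (by norm_num)]
    simp only [repr_schrodingerFlow, norm_mul, norm_schrodingerSymbol, one_mul]

theorem schrodingerIsometry_apply (t : ℝ) (u : L2Torus) :
    schrodingerIsometry t u = schrodingerFlow t u := rfl

theorem schrodingerFlow_fourierBasis (t : ℝ) (n : ℤ) :
    schrodingerFlow t (fourierBasis n) = schrodingerSymbol t n • fourierBasis n := by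
  apply fourierBasis.repr.injective
  ext m
  rw [repr_schrodingerFlow, map_smul, HilbertBasis.repr_self, lp.coeFn_smul, Pi.smul_apply,
    smul_eq_mul]
  by_cases h : m = n
  · rw [h]
  · rw [lp.single_apply_ne _ _ _ h, mul_zero, mul_zero]

theorem schrodingerSymbol_eq (t : ℝ) (n : ℤ) :
    schrodingerSymbol t n = exp ((-(2 * Real.pi * (n.natAbs : ℝ)) ^ 2 * t : ℝ) * I) := by
  rw [schrodingerSymbol, Nat.cast_natAbs, Int.cast_abs, mul_pow _ |(n : ℝ)|, sq_abs]
  congr 1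
  push_cast
  linear_combination (t * (2 * Real.pi) ^ 2 * n ^ 2 * I : ℂ) * I_sq

theorem dense_span_fourierBasis :
    Dense (Submodule.span ℂ (Set.range (fourierBasis : HilbertBasis ℤ ℂ L2Torus)) : Set L2Torus) := by
  rw [Submodule.dense_iff_topologicalClosure_eq_top]
  exact fourierBasis.dense_span

/-- The flow is 1-Lipschitz in the data uniformly in time, so continuity in time is only needed on
the dense span of the modes, where it is explicit. -/
theorem continuous_schrodingerFlow : Continuous fun p : L2Torus × ℝ => schrodingerFlow p.2 p.1 := by
  refine continuous_prod_of_dense_continuous_lipschitzWith _ 1 dense_span_fourierBasis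
    (fun u hu => ?_) fun t => (schrodingerIsometry t).lipschitz
  refine Submodule.span_induction (p := fun u _ => Continuous fun t => schrodingerFlow t u)
    ?_ ?_ (fun u w _ _ hu hw => ?_) (fun c u _ hu => ?_) hu
  · rintro _ ⟨n, rfl⟩
    simp_rw [schrodingerFlow_fourierBasis, schrodingerSymbol]
    fun_prop
  · simp_rw [← schrodingerIsometry_apply, map_zero]
    exact continuous_const
  · simp_rw [← schrodingerIsometry_apply, map_add]
    exact hu.add hw
  · simp_rw [← schrodingerIsometry_apply, map_smul]
    exact hu.const_smul c

theorem coeFn_cutoff {ω : Set (AddCircle (1 : ℝ))} (hω : MeasurableSet ω) (v : L2Torus) :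
    cutoff ω hω v =ᵐ[AddCircle.haarAddCircle] ω.indicator v :=
  MemLp.coeFn_toLp _

theorem norm_cutoff_le {ω : Set (AddCircle (1 : ℝ))} (hω : MeasurableSet ω) (v : L2Torus) :
    ‖cutoff ω hω v‖ ≤ ‖v‖ := by
  refine Lp.norm_le_norm_of_ae_le ?_
  filter_upwards [coeFn_cutoff hω v] with x hx
  rw [hx]
  exact norm_indicator_le_norm_self _ _

/-- Multiplication by `1_ω` as a bounded operator. -/
noncomputable def cutoffCLM {ω : Set (AddCircle (1 : ℝ))} (hω : MeasurableSet ω) :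
    L2Torus →L[ℂ] L2Torus :=
  LinearMap.mkContinuous
    { toFun := cutoff ω hω
      map_add' := fun u w => by
        ext1
        filter_upwards [coeFn_cutoff hω (u + w), coeFn_cutoff hω u, coeFn_cutoff hω w,
          Lp.coeFn_add u w, Lp.coeFn_add (cutoff ω hω u) (cutoff ω hω w)] with x h1 h2 h3 h4 h5
        rw [h1, h5, Pi.add_apply, h2, h3]
        by_cases hx : x ∈ ω
        · simp only [Set.indicator_of_mem hx, h4, Pi.add_apply]
        · simp only [Set.indicator_of_notMem hx, add_zero]
      map_smul' := fun c u => by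
        ext1
        filter_upwards [coeFn_cutoff hω (c • u), coeFn_cutoff hω u,
          Lp.coeFn_smul c u, Lp.coeFn_smul c (cutoff ω hω u)] with x h1 h2 h3 h4
        rw [h1, RingHom.id_apply, h4, Pi.smul_apply, h2]
        by_cases hx : x ∈ ω <;> simp [hx, h3] } 1 fun v => by
      rw [one_mul]
      exact norm_cutoff_le hω v

theorem cutoffCLM_apply {ω : Set (AddCircle (1 : ℝ))} (hω : MeasurableSet ω) (v : L2Torus) :
    cutoffCLM hω v = cutoff ω hω v := rfl

theorem norm_sq_eq_integral (v : L2Torus) :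
    ‖v‖ ^ 2 = ∫ x, ‖v x‖ ^ 2 ∂AddCircle.haarAddCircle := by
  rw [norm_sq_eq_re_inner (𝕜 := ℂ) v, L2.inner_def, ← integral_re (L2.integrable_inner v v)]
  refine integral_congr_ae (Filter.Eventually.of_forall fun x => ?_)
  exact (norm_sq_eq_re_inner (𝕜 := ℂ) (v x)).symm

theorem norm_sq_cutoff_toLp {ω : Set (AddCircle (1 : ℝ))} (hω : MeasurableSet ω)
    (g : C(AddCircle (1 : ℝ), ℂ)) (a : ℝ) :
    ‖cutoff ω hω (ContinuousMap.toLp 2 AddCircle.haarAddCircle ℂ g)‖ ^ 2 =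
      ∫ x in a..(a + 1), ω.indicator (fun y => ‖g y‖ ^ 2) (x : AddCircle (1 : ℝ)) := by
  have h : ‖cutoff ω hω (ContinuousMap.toLp 2 AddCircle.haarAddCircle ℂ g)‖ ^ 2 =
      ∫ x, ω.indicator (fun y => ‖g y‖ ^ 2) x ∂AddCircle.haarAddCircle := by
    rw [norm_sq_eq_integral]
    refine integral_congr_ae ?_
    filter_upwards [coeFn_cutoff hω (ContinuousMap.toLp 2 AddCircle.haarAddCircle ℂ g),
      ContinuousMap.coeFn_toLp (p := 2) (𝕜 := ℂ) AddCircle.haarAddCircle g] with x h1 h2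
    rw [h1]
    by_cases hx : x ∈ ω
    · simp only [Set.indicator_of_mem hx, h2]
    · simp [Set.indicator_of_notMem hx]
  rw [h, AddCircle.intervalIntegral_preimage, AddCircle.integral_haarAddCircle, inv_one, one_smul]

theorem integral_le_norm_sq_cutoff_toLp {ω : Set (AddCircle (1 : ℝ))} (hω : MeasurableSet ω)
    (g : C(AddCircle (1 : ℝ), ℂ)) {a b : ℝ} (hab : a ≤ b) (hb : b ≤ a + 1)
    (hsub : ∀ x ∈ Set.Icc a b, (x : AddCircle (1 : ℝ)) ∈ ω) :
    ∫ x in a..b, ‖g (x : AddCircle (1 : ℝ))‖ ^ 2 ≤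
      ‖cutoff ω hω (ContinuousMap.toLp 2 AddCircle.haarAddCircle ℂ g)‖ ^ 2 := by
  -- The period is cut at the left end of the arc, so that `[a, b]` lies in one fundamental domain.
  rw [norm_sq_cutoff_toLp hω g a]
  have hg : Continuous fun x : ℝ => ‖g (x : AddCircle (1 : ℝ))‖ ^ 2 :=
    (g.continuous.comp (AddCircle.continuous_mk' 1)).norm.pow 2
  have h1 : ∫ x in a..b, ‖g (x : AddCircle (1 : ℝ))‖ ^ 2 =
      ∫ x in a..b, ω.indicator (fun y => ‖g y‖ ^ 2) (x : AddCircle (1 : ℝ)) := by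
    refine intervalIntegral.integral_congr fun x hx => ?_
    rw [Set.uIcc_of_le hab] at hx
    exact (Set.indicator_of_mem (hsub x hx) (fun y => ‖g y‖ ^ 2)).symm
  rw [h1]
  refine intervalIntegral.integral_mono_interval le_rfl hab hb
    (Filter.Eventually.of_forall fun x => Set.indicator_nonneg (fun _ _ => sq_nonneg _) _) ?_
  rw [intervalIntegrable_iff]
  exact ((intervalIntegrable_iff.1 (hg.intervalIntegrable a (a + 1))).indicator
    (hω.preimage (AddCircle.continuous_mk' 1).measurable))

theorem exists_Icc_subset_of_isOpen {ω : Set (AddCircle (1 : ℝ))} (hω : IsOpen ω)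
    (hne : ω.Nonempty) :
    ∃ a b : ℝ, a < b ∧ b ≤ a + 1 ∧ ∀ x ∈ Set.Icc a b, (x : AddCircle (1 : ℝ)) ∈ ω := by
  obtain ⟨y, hy⟩ := hne
  obtain ⟨x, rfl⟩ := QuotientAddGroup.mk_surjective y
  obtain ⟨ε, hε, h⟩ := Metric.isOpen_iff.1 (hω.preimage (AddCircle.continuous_mk' 1)) x hy
  refine ⟨x, x + min (ε / 2) 1, by linarith [show 0 < min (ε / 2) 1 by positivity],
    by linarith [min_le_right (ε / 2) 1], fun z hz => h ?_⟩
  rw [Metric.mem_ball, Real.dist_eq, abs_of_nonneg (sub_nonneg.2 hz.1)]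
  linarith [hz.2, min_le_left (ε / 2) 1]

theorem exists_le_norm_sq_cutoff_of_natAbs_eq {ω : Set (AddCircle (1 : ℝ))} (hω : IsOpen ω)
    (hne : ω.Nonempty) :
    ∃ κ : ℝ, 0 < κ ∧ ∀ (k : ℕ) (F : Finset ℤ) (c : ℤ → ℂ), (∀ n ∈ F, n.natAbs = k) →
      κ * ∑ n ∈ F, ‖c n‖ ^ 2 ≤
        ‖cutoff ω hω.measurableSet (∑ n ∈ F, c n • (fourierBasis n : L2Torus))‖ ^ 2 := by
  obtain ⟨a, b, hab, hb, hsub⟩ := exists_Icc_subset_of_isOpen hω hne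
  obtain ⟨κ, hκ, h⟩ := exists_le_integral_norm_sq_trigSum_of_natAbs_eq' hab
  refine ⟨κ, hκ, fun k F c hF => (h k F c hF).trans ?_⟩
  have h1 := integral_le_norm_sq_cutoff_toLp hω.measurableSet (∑ n ∈ F, c n • fourier n)
    hab.le hb hsub
  rw [map_sum] at h1
  simp_rw [map_smul] at h1
  rw [coe_fourierBasis]
  refine le_trans (le_of_eq ?_) h1
  refine intervalIntegral.integral_congr fun x _ => ?_
  simp only [trigSum, ContinuousMap.coe_sum, Finset.sum_apply, ContinuousMap.coe_smul,
    Pi.smul_apply, fourier_coe_apply, smul_eq_mul]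
  congr 2
  refine Finset.sum_congr rfl fun n _ => ?_
  rw [mul_comm]
  congr 2
  push_cast
  ring

/-- Modes are grouped by `|n|`, because `n` and `-n` share a time frequency and Ingham's inequality
needs distinct ones. -/
theorem cutoff_schrodingerFlow_sum {ω : Set (AddCircle (1 : ℝ))} (hω : MeasurableSet ω) (t : ℝ)
    (F : Finset ℤ) (c : ℤ → ℂ) :
    cutoff ω hω (schrodingerFlow t (∑ n ∈ F, c n • (fourierBasis n : L2Torus))) =
      trigSum (fun k : ℕ => -(2 * Real.pi * (k : ℝ)) ^ 2) (F.image Int.natAbs)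
        (fun k => cutoff ω hω (∑ n ∈ F with n.natAbs = k, c n • (fourierBasis n : L2Torus))) t := by
  simp_rw [trigSum, ← cutoffCLM_apply, ← schrodingerIsometry_apply, map_sum, map_smul,
    schrodingerIsometry_apply, schrodingerFlow_fourierBasis, map_smul, Finset.smul_sum]
  rw [← Finset.sum_fiberwise_of_maps_to (fun n hn => Finset.mem_image_of_mem Int.natAbs hn)]
  refine Finset.sum_congr rfl fun k _ => Finset.sum_congr rfl fun n hn => ?_
  rw [schrodingerSymbol_eq, (Finset.mem_filter.1 hn).2, smul_comm]

theorem norm_sq_sum_smul_fourierBasis (F : Finset ℤ) (c : ℤ → ℂ) :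
    ‖∑ n ∈ F, c n • (fourierBasis n : L2Torus)‖ ^ 2 = ∑ n ∈ F, ‖c n‖ ^ 2 := by
  rw [norm_sq_eq_re_inner (𝕜 := ℂ), (fourierBasis (T := 1)).orthonormal.inner_sum]
  change re _ = _
  rw [re_sum]
  refine Finset.sum_congr rfl fun n _ => ?_
  rw [← normSq_eq_conj_mul_self, ofReal_re, normSq_eq_norm_sq]

theorem observability_of_mem_span {ω : Set (AddCircle (1 : ℝ))} (hω : IsOpen ω)
    (hne : ω.Nonempty) {T : ℝ} (hT : 0 < T) :
    ∃ c : ℝ, 0 < c ∧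
      ∀ u ∈ Submodule.span ℂ (Set.range (fourierBasis : HilbertBasis ℤ ℂ L2Torus)),
      c * ‖u‖ ^ 2 ≤
        ∫ t in (0 : ℝ)..T, ‖cutoff ω hω.measurableSet (schrodingerFlow t u)‖ ^ 2 := by
  obtain ⟨κ, hκ, hloc⟩ := exists_le_norm_sq_cutoff_of_natAbs_eq hω hne
  obtain ⟨c, hc, hing⟩ := exists_le_integral_norm_sq_trigSum L2Torus injective_neg_two_pi_mul_sq
    summable_inv_sub_sq hT
  refine ⟨c * κ, by positivity, fun u hu => ?_⟩
  obtain ⟨a, rfl⟩ := Finsupp.mem_span_range_iff_exists_finsupp.1 hu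
  rw [Finsupp.sum, norm_sq_sum_smul_fourierBasis]
  simp_rw [cutoff_schrodingerFlow_sum]
  refine le_trans ?_ (hing _ _)
  rw [mul_assoc]
  refine mul_le_mul_of_nonneg_left ?_ hc.le
  rw [← Finset.sum_fiberwise_of_maps_to (fun n hn => Finset.mem_image_of_mem Int.natAbs hn),
    Finset.mul_sum]
  exact Finset.sum_le_sum fun k _ => hloc k _ _ fun n hn => (Finset.mem_filter.1 hn).2

end Torus

theorem theorem3p1 (ω : Set (AddCircle (1 : ℝ))) (hω : IsOpen ω) (hne : ω.Nonempty)
    (T : ℝ) (hT : 0 < T) :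
    ∃ C : ℝ, 0 < C ∧ ∀ u₀ : L2Torus,
      IntervalIntegrable (fun t : ℝ => ‖cutoff ω hω.measurableSet (schrodingerFlow t u₀)‖ ^ 2)
        volume 0 T ∧
      ‖u₀‖ ^ 2 ≤
        C * ∫ t in (0 : ℝ)..T, ‖cutoff ω hω.measurableSet (schrodingerFlow t u₀)‖ ^ 2 := by
  have hcont : Continuous (Function.uncurry fun (u : L2Torus) (t : ℝ) =>
      ‖cutoff ω hω.measurableSet (schrodingerFlow t u)‖ ^ 2) :=
    ((cutoffCLM hω.measurableSet).continuous.comp continuous_schrodingerFlow).norm.pow 2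
  obtain ⟨c, hc, h⟩ := observability_of_mem_span hω hne hT
  refine ⟨c⁻¹, inv_pos.2 hc, fun u₀ => ⟨(hcont.comp
    (Continuous.prodMk_right u₀)).intervalIntegrable 0 T, ?_⟩⟩
  rw [le_inv_mul_iff₀ hc]
  -- Both sides are continuous in the data, so the inequality passes from finite Fourier sums to
  -- their closure.
  have hclosed : IsClosed {u : L2Torus | c * ‖u‖ ^ 2 ≤
      ∫ t in (0 : ℝ)..T, ‖cutoff ω hω.measurableSet (schrodingerFlow t u)‖ ^ 2} :=
    isClosed_le (by fun_prop)
      (intervalIntegral.continuous_parametric_intervalIntegral_of_continuous' hcont 0 T)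
  exact dense_span_fourierBasis.induction h hclosed u₀
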